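/- Let $L_2=L_2(0,\infty)$ and $L_\infty=L_\infty(0,\infty)$ be the Lebesgue spaces of (equivalence classes of) real-valued or complex-valued measurable functions on $(0,\infty)$ with Lebesgue measure. Let $L_2+L_\infty$ be the space of all sums $x=u+v$ with $u\in L_2$, $v\in L_\infty$, with the norm $$\|x\|_{L_2+L_\infty}=\inf\{\|u\|_{L_2}+\|v\|_{L_\infty}: x=u+v,\ u\in L_2,\ v\in L_\infty\},$$ and let $L_2\cap L_\infty$ be the space of all functions that belong to both $L_2$ and $L_\infty$, with the norm $\|x\|_{L_2\cap L_\infty}=\max\{\|x\|_{L_2},\|x\|_{L_\infty}\}$. Then $L_2+L_\infty$ and $L_2\cap L_\infty$ are not isomorphic: there is no linear homeomorphism of $L_2+L_\infty$ onto $L_2\cap L_\infty$. -/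

import Mathlib

open MeasureTheory
open scoped ENNReal

/-- Lebesgue measure on the half-line `(0, ∞)`. -/
noncomputable def halfLine : Measure ℝ := volume.restrict (Set.Ioi 0)

section Spaces

variable (𝕜 : Type*) [RCLike 𝕜] {α : Type*} [MeasurableSpace α]

/-- The vector space `L_p + L_q` of (classes of) measurable functions `u + v` with `u ∈ L_p` and
`v ∈ L_q`. -/
def LpSum (p q : ℝ≥0∞) (μ : Measure α) : Submodule 𝕜 (α →ₘ[μ] 𝕜) :=
  Lp.LpSubmodule 𝕜 𝕜 p μ ⊔ Lp.LpSubmodule 𝕜 𝕜 q μ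

/-- The vector space `L_p ∩ L_q` of (classes of) measurable functions lying in `L_p` and in
`L_q`. -/
def LpInter (p q : ℝ≥0∞) (μ : Measure α) : Submodule 𝕜 (α →ₘ[μ] 𝕜) :=
  Lp.LpSubmodule 𝕜 𝕜 p μ ⊓ Lp.LpSubmodule 𝕜 𝕜 q μ

variable {𝕜} {p q : ℝ≥0∞} {μ : Measure α}

/-- `‖x‖ = inf { ‖u‖_p + ‖v‖_q : x = u + v, u ∈ L_p, v ∈ L_q }`. -/
noncomputable instance LpSum.instNorm : Norm (LpSum 𝕜 p q μ) where
  norm x := sInf {r : ℝ | ∃ (u : Lp 𝕜 p μ) (v : Lp 𝕜 q μ),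
    (x : α →ₘ[μ] 𝕜) = (u : α →ₘ[μ] 𝕜) + (v : α →ₘ[μ] 𝕜) ∧ r = ‖u‖ + ‖v‖}

/-- `‖x‖ = max (‖x‖_p, ‖x‖_q)`. -/
noncomputable instance LpInter.instNorm : Norm (LpInter 𝕜 p q μ) where
  norm x := max ‖(⟨x, x.2.1⟩ : Lp 𝕜 p μ)‖ ‖(⟨x, x.2.2⟩ : Lp 𝕜 q μ)‖

theorem LpSum.bddBelow (x : LpSum 𝕜 p q μ) :
    BddBelow {r : ℝ | ∃ (u : Lp 𝕜 p μ) (v : Lp 𝕜 q μ),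
      (x : α →ₘ[μ] 𝕜) = (u : α →ₘ[μ] 𝕜) + (v : α →ₘ[μ] 𝕜) ∧ r = ‖u‖ + ‖v‖} := by
  refine ⟨0, ?_⟩
  rintro r ⟨u, v, -, rfl⟩
  exact add_nonneg ENNReal.toReal_nonneg ENNReal.toReal_nonneg

theorem LpSum.norm_le (x : LpSum 𝕜 p q μ) (u : Lp 𝕜 p μ) (v : Lp 𝕜 q μ)
    (h : (x : α →ₘ[μ] 𝕜) = (u : α →ₘ[μ] 𝕜) + (v : α →ₘ[μ] 𝕜)) : ‖x‖ ≤ ‖u‖ + ‖v‖ :=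
  csInf_le (LpSum.bddBelow x) ⟨u, v, h, rfl⟩

theorem LpSum.exists_lt (x : LpSum 𝕜 p q μ) {c : ℝ} (hc : ‖x‖ < c) :
    ∃ (u : Lp 𝕜 p μ) (v : Lp 𝕜 q μ),
      (x : α →ₘ[μ] 𝕜) = (u : α →ₘ[μ] 𝕜) + (v : α →ₘ[μ] 𝕜) ∧ ‖u‖ + ‖v‖ < c := by
  have hne : {r : ℝ | ∃ (u : Lp 𝕜 p μ) (v : Lp 𝕜 q μ),
      (x : α →ₘ[μ] 𝕜) = (u : α →ₘ[μ] 𝕜) + (v : α →ₘ[μ] 𝕜) ∧ r = ‖u‖ + ‖v‖}.Nonempty := by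
    obtain ⟨u, hu, v, hv, h⟩ := Submodule.mem_sup.1 x.2
    exact ⟨_, ⟨u, hu⟩, ⟨v, hv⟩, h.symm, rfl⟩
  obtain ⟨r, ⟨u, v, h, rfl⟩, hr⟩ := exists_lt_of_csInf_lt hne hc
  exact ⟨u, v, h, hr⟩

variable [Fact (1 ≤ p)] [Fact (1 ≤ q)]

theorem LpSum.norm_nonneg' (x : LpSum 𝕜 p q μ) : 0 ≤ ‖x‖ := by
  refine Real.sInf_nonneg ?_
  rintro r ⟨u, v, -, rfl⟩
  positivity

theorem LpSum.norm_smul_le' (c : 𝕜) (x : LpSum 𝕜 p q μ) : ‖c • x‖ ≤ ‖c‖ * ‖x‖ := by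
  refine le_of_forall_pos_le_add fun ε hε => ?_
  have hd : 0 < ‖c‖ + 1 := by positivity
  obtain ⟨u, v, h, hr⟩ := LpSum.exists_lt x (lt_add_of_pos_right ‖x‖ (div_pos hε hd))
  have h1 : ‖c • x‖ ≤ ‖c • u‖ + ‖c • v‖ := by
    refine LpSum.norm_le _ _ _ ?_
    rw [Submodule.coe_smul, h, smul_add]
    rfl
  rw [norm_smul c u, norm_smul c v, ← mul_add] at h1
  have h2 : ‖c‖ * (ε / (‖c‖ + 1)) ≤ ε := by
    rw [mul_div_assoc', div_le_iff₀ hd]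
    nlinarith
  nlinarith [mul_le_mul_of_nonneg_left hr.le (norm_nonneg c)]

theorem LpSum.norm_add_le' (x y : LpSum 𝕜 p q μ) : ‖x + y‖ ≤ ‖x‖ + ‖y‖ := by
  refine le_of_forall_pos_le_add fun ε hε => ?_
  obtain ⟨u, v, h, hr⟩ := LpSum.exists_lt x (lt_add_of_pos_right ‖x‖ (half_pos hε))
  obtain ⟨u', v', h', hr'⟩ := LpSum.exists_lt y (lt_add_of_pos_right ‖y‖ (half_pos hε))
  have h1 : ‖x + y‖ ≤ ‖u + u'‖ + ‖v + v'‖ := by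
    refine LpSum.norm_le _ _ _ ?_
    rw [Submodule.coe_add, h, h', add_add_add_comm]
    rfl
  linarith [norm_add_le u u', norm_add_le v v']

theorem LpSum.eq_zero_of_norm_eq_zero (x : LpSum 𝕜 p q μ) (hx : ‖x‖ = 0) : x = 0 := by
  have hex : ∀ n : ℕ, ∃ (u : Lp 𝕜 p μ) (v : Lp 𝕜 q μ),
      (x : α →ₘ[μ] 𝕜) = (u : α →ₘ[μ] 𝕜) + (v : α →ₘ[μ] 𝕜) ∧ ‖u‖ + ‖v‖ < 1 / ((n : ℝ) + 1) :=
    fun n => LpSum.exists_lt x (by rw [hx]; positivity)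
  choose u v h hlt using hex
  have hu : Filter.Tendsto u Filter.atTop (nhds 0) :=
    squeeze_zero_norm (fun n => by linarith [hlt n, norm_nonneg (v n)])
      tendsto_one_div_add_atTop_nhds_zero_nat
  have hv : Filter.Tendsto v Filter.atTop (nhds 0) :=
    squeeze_zero_norm (fun n => by linarith [hlt n, norm_nonneg (u n)])
      tendsto_one_div_add_atTop_nhds_zero_nat
  obtain ⟨ns, hns, hu'⟩ := (tendstoInMeasure_of_tendsto_Lp hu).exists_seq_tendsto_ae
  obtain ⟨ms, hms, hv'⟩ := (tendstoInMeasure_of_tendsto_Lp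
    (hv.comp hns.tendsto_atTop)).exists_seq_tendsto_ae
  refine Subtype.ext (AEEqFun.ext ?_)
  have hsum : ∀ᵐ t ∂μ, ∀ n, (x : α →ₘ[μ] 𝕜) t = u n t + v n t := by
    refine ae_all_iff.2 fun n => ?_
    rw [h n]
    exact AEEqFun.coeFn_add _ _
  have hz : ((0 : LpSum 𝕜 p q μ) : α →ₘ[μ] 𝕜) =ᵐ[μ] 0 := AEEqFun.coeFn_zero
  filter_upwards [hu', hv', hsum, Lp.coeFn_zero 𝕜 p μ, Lp.coeFn_zero 𝕜 q μ, hz]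
    with t h1 h2 h3 h4 h5 h6
  rw [h6]
  have h7 := (h1.comp hms.tendsto_atTop).add h2
  rw [h4, h5] at h7
  refine tendsto_nhds_unique (tendsto_const_nhds.congr fun n => ?_) (h7.trans (by simp))
  exact h3 (ns (ms n))

theorem LpSum.core : NormedSpace.Core 𝕜 (LpSum 𝕜 p q μ) where
  norm_nonneg := LpSum.norm_nonneg'
  norm_smul c x := by
    refine le_antisymm (LpSum.norm_smul_le' c x) ?_
    rcases eq_or_ne c 0 with rfl | hc
    · simpa using LpSum.norm_nonneg' ((0 : 𝕜) • x)
    · have h := LpSum.norm_smul_le' c⁻¹ (c • x)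
      rw [inv_smul_smul₀ hc, norm_inv] at h
      have hc' : 0 < ‖c‖ := norm_pos_iff.2 hc
      calc ‖c‖ * ‖x‖ ≤ ‖c‖ * (‖c‖⁻¹ * ‖c • x‖) := by gcongr
        _ = ‖c • x‖ := mul_inv_cancel_left₀ hc'.ne' _
  norm_triangle := LpSum.norm_add_le'
  norm_eq_zero_iff x := by
    refine ⟨LpSum.eq_zero_of_norm_eq_zero x, ?_⟩
    rintro rfl
    refine le_antisymm ?_ (LpSum.norm_nonneg' _)
    simpa using LpSum.norm_le (0 : LpSum 𝕜 p q μ) 0 0 (by simp)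

theorem LpInter.core : NormedSpace.Core 𝕜 (LpInter 𝕜 p q μ) where
  norm_nonneg x := (norm_nonneg _).trans (le_max_left _ _)
  norm_smul c x := by
    have h1 := norm_smul c (⟨x, x.2.1⟩ : Lp 𝕜 p μ)
    have h2 := norm_smul c (⟨x, x.2.2⟩ : Lp 𝕜 q μ)
    exact (congrArg₂ max h1 h2).trans (mul_max_of_nonneg _ _ (norm_nonneg c)).symm
  norm_triangle x y := by
    have h1 := norm_add_le (⟨x, x.2.1⟩ : Lp 𝕜 p μ) ⟨y, y.2.1⟩
    have h2 := norm_add_le (⟨x, x.2.2⟩ : Lp 𝕜 q μ) ⟨y, y.2.2⟩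
    exact max_le (h1.trans (add_le_add (le_max_left _ _) (le_max_left _ _)))
      (h2.trans (add_le_add (le_max_right _ _) (le_max_right _ _)))
  norm_eq_zero_iff x := by
    constructor
    · intro h
      have h1 : ‖(⟨x, x.2.1⟩ : Lp 𝕜 p μ)‖ ≤ 0 := (le_max_left _ _).trans h.le
      have h2 := norm_le_zero_iff.1 h1
      exact Subtype.ext (congrArg (fun f : Lp 𝕜 p μ => (f : α →ₘ[μ] 𝕜)) h2)
    · rintro rfl
      have h1 : ‖(0 : Lp 𝕜 p μ)‖ = 0 := norm_zero
      have h2 : ‖(0 : Lp 𝕜 q μ)‖ = 0 := norm_zero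
      exact (congrArg₂ max h1 h2).trans (max_self 0)

noncomputable instance LpSum.instNormedAddCommGroup : NormedAddCommGroup (LpSum 𝕜 p q μ) :=
  NormedAddCommGroup.ofCore (LpSum.core (𝕜 := 𝕜))

noncomputable instance LpInter.instNormedAddCommGroup : NormedAddCommGroup (LpInter 𝕜 p q μ) :=
  NormedAddCommGroup.ofCore (LpInter.core (𝕜 := 𝕜))

noncomputable instance LpSum.instNormedSpace : NormedSpace 𝕜 (LpSum 𝕜 p q μ) where
  norm_smul_le := LpSum.norm_smul_le'

noncomputable instance LpInter.instNormedSpace : NormedSpace 𝕜 (LpInter 𝕜 p q μ) where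
  norm_smul_le c x := (LpInter.core.norm_smul c x).le

end Spaces

/-! Cut the half-line into disjoint cells of measure `1/n`, and let `T` be an isomorphism such that
`T` and its inverse have norm at most `C`. In `L_2 + L_∞` every finite signed sum of cell indicators
has norm at most 1, so averaging over signs in `L_2` makes the squared `L_2`-norms of their images
summable. Far enough out there are therefore `n` cells whose images are negligible in `L_2`, and on
these images `L_2 ∩ L_∞` behaves like `L_∞`.

On the domain side, the indicators of these `n` cells have an upper `ℓ_2` estimate with constant
`n^{-1/2}`, while the integrals over the cells map `L_2 + L_∞` contractively into `ℓ_1^n`, the total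
measure being 1. After rescaling, `T` and its inverse thus factor `√n / C` times the identity of
`ℓ_2^n` into `ℓ_1^n` through an `L_∞`-like space. Grothendieck's theorem forbids this for large `n`:
the diagonal sum is `√n / C`, but must be at most `2 C`.

The Grothendieck bound `SmallSquare.norm_sum_apply_le` is self-improving. A family is the Rademacher
mean of its own signed sums; truncating these sums leaves a contribution of at most `D`, and twice
the truncation error is again an admissible family. Hence the supremum `V` of the diagonal sums
satisfies `V ≤ D + V / 2`. -/

/-! ### Moments and orthogonality of Rademacher sums. -/

section Rademacher

open Finset

variable {ι : Type*} [DecidableEq ι]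

/-- The value at the sign vector encoded by `A` of the `i`-th Rademacher function. -/
def rademacher (𝕜 : Type*) [RCLike 𝕜] (A : Finset ι) (i : ι) : 𝕜 := if i ∈ A then 1 else -1

variable {𝕜 : Type*} [RCLike 𝕜] {E : Type*} [NormedAddCommGroup E] [InnerProductSpace 𝕜 E]

theorem rademacher_of_mem {A : Finset ι} {i : ι} (h : i ∈ A) : rademacher 𝕜 A i = 1 := if_pos h

theorem rademacher_of_notMem {A : Finset ι} {i : ι} (h : i ∉ A) : rademacher 𝕜 A i = -1 :=
  if_neg h

theorem norm_rademacher (A : Finset ι) (i : ι) : ‖rademacher 𝕜 A i‖ = 1 := by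
  unfold rademacher; split_ifs <;> simp

theorem rademacher_mul_self (A : Finset ι) (i : ι) : rademacher 𝕜 A i * rademacher 𝕜 A i = 1 := by
  unfold rademacher; split_ifs <;> simp

theorem conj_rademacher (A : Finset ι) (i : ι) :
    (starRingEnd 𝕜) (rademacher 𝕜 A i) = rademacher 𝕜 A i := by
  unfold rademacher; split_ifs <;> simp

theorem sum_rademacher_mul [Fintype ι] {i j : ι} (hij : i ≠ j) :
    ∑ A : Finset ι, rademacher 𝕜 A i * rademacher 𝕜 A j = 0 := by
  -- Toggling `i` flips the `i`-th sign and keeps the `j`-th, so terms cancel in pairs.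
  refine Finset.sum_involution (fun A _ => symmDiff A {i}) ?_ ?_ ?_ ?_
  · intro A _
    have h1 : j ∈ symmDiff A {i} ↔ j ∈ A := by simp [mem_symmDiff, hij.symm]
    have h2 : i ∈ symmDiff A {i} ↔ i ∉ A := by simp [mem_symmDiff]
    simp only [rademacher, h1, h2]
    split_ifs <;> simp
  · intro A _ _ h
    simp at h
  · simp
  · intro A _
    simp

theorem sum_rademacher_smul_sum [Fintype ι] (z : ι → E) (i : ι) :
    ∑ A : Finset ι, rademacher 𝕜 A i • ∑ j, rademacher 𝕜 A j • z j
      = (2 ^ Fintype.card ι : 𝕜) • z i := by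
  simp_rw [smul_sum, smul_smul]
  rw [sum_comm]
  simp_rw [← sum_smul]
  rw [sum_eq_single i]
  · simp [rademacher_mul_self]
  · intro j _ hj
    rw [sum_rademacher_mul hj.symm, zero_smul]
  · simp

/-- Conditioning on the sign at `a`; this is the induction step for both moment formulas. -/
theorem sum_powerset_insert_rademacher {S : Finset ι} {a : ι} (ha : a ∉ S) (z : ι → E)
    (F : E → ℝ) :
    ∑ A ∈ (insert a S).powerset, F (∑ i ∈ insert a S, rademacher 𝕜 A i • z i)
      = ∑ A ∈ S.powerset, (F (∑ i ∈ S, rademacher 𝕜 A i • z i - z a)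
        + F (∑ i ∈ S, rademacher 𝕜 A i • z i + z a)) := by
  rw [sum_powerset_insert ha, ← sum_add_distrib]
  refine sum_congr rfl fun A hA => ?_
  have haA : a ∉ A := fun h => ha (mem_powerset.1 hA h)
  rw [sum_insert ha, sum_insert ha, rademacher_of_notMem haA,
    rademacher_of_mem (mem_insert_self a A), neg_one_smul, one_smul, neg_add_eq_sub, add_comm (z a)]
  congr 3
  refine sum_congr rfl fun i hi => ?_
  have : i ≠ a := fun h => ha (h ▸ hi)
  simp [rademacher, this]

theorem norm_sub_sq_add_norm_add_sq (𝕜 : Type*) [RCLike 𝕜] {E : Type*} [NormedAddCommGroup E]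
    [InnerProductSpace 𝕜 E] (x b : E) :
    ‖x - b‖ ^ 2 + ‖x + b‖ ^ 2 = 2 * ‖x‖ ^ 2 + 2 * ‖b‖ ^ 2 := by
  rw [@norm_sub_sq 𝕜, @norm_add_sq 𝕜]
  ring

theorem norm_sub_pow_four_add_norm_add_pow_four_le (𝕜 : Type*) [RCLike 𝕜] {E : Type*} [NormedAddCommGroup E]
    [InnerProductSpace 𝕜 E] (x b : E) :
    ‖x - b‖ ^ 4 + ‖x + b‖ ^ 4 ≤ 2 * ‖x‖ ^ 4 + 12 * ‖b‖ ^ 2 * ‖x‖ ^ 2 + 2 * ‖b‖ ^ 4 := by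
  have h1 := @norm_sub_sq 𝕜 _ _ _ _ x b
  have h2 := @norm_add_sq 𝕜 _ _ _ _ x b
  have h3 : (RCLike.re (inner 𝕜 x b)) ^ 2 ≤ (‖x‖ * ‖b‖) ^ 2 := by
    rw [sq_le_sq, abs_of_nonneg (by positivity : 0 ≤ ‖x‖ * ‖b‖)]
    exact (RCLike.abs_re_le_norm _).trans (norm_inner_le_norm x b)
  have e1 : ‖x - b‖ ^ 4 = (‖x - b‖ ^ 2) ^ 2 := by ring
  have e2 : ‖x + b‖ ^ 4 = (‖x + b‖ ^ 2) ^ 2 := by ring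
  rw [e1, e2, h1, h2]
  nlinarith

theorem sum_powerset_norm_sq (S : Finset ι) (z : ι → E) :
    ∑ A ∈ S.powerset, ‖∑ i ∈ S, rademacher 𝕜 A i • z i‖ ^ 2
      = 2 ^ S.card * ∑ i ∈ S, ‖z i‖ ^ 2 := by
  induction S using Finset.induction_on with
  | empty => simp
  | insert a S ha ih =>
    rw [sum_powerset_insert_rademacher ha z fun x => ‖x‖ ^ 2]
    simp_rw [norm_sub_sq_add_norm_add_sq 𝕜]
    rw [sum_add_distrib, ← mul_sum, ih, sum_insert ha, card_insert_of_notMem ha]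
    simp
    ring

theorem sum_powerset_norm_pow_four_le (S : Finset ι) (z : ι → E) :
    ∑ A ∈ S.powerset, ‖∑ i ∈ S, rademacher 𝕜 A i • z i‖ ^ 4
      ≤ 2 ^ S.card * (3 * (∑ i ∈ S, ‖z i‖ ^ 2) ^ 2) := by
  induction S using Finset.induction_on with
  | empty => simp
  | insert a S ha ih =>
    rw [sum_powerset_insert_rademacher ha z fun x => ‖x‖ ^ 4]
    refine (sum_le_sum fun A _ =>
      norm_sub_pow_four_add_norm_add_pow_four_le 𝕜 _ _).trans ?_
    rw [sum_add_distrib, sum_add_distrib, ← mul_sum, ← mul_sum, sum_powerset_norm_sq,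
      sum_insert ha, card_insert_of_notMem ha]
    simp only [sum_const, card_powerset, nsmul_eq_mul, Nat.cast_pow, Nat.cast_ofNat]
    have : (0 : ℝ) ≤ 2 ^ S.card * ‖z a‖ ^ 4 := by positivity
    rw [pow_succ 2 S.card]
    nlinarith

variable [Fintype ι]

/-- Bessel's inequality for the Rademacher system, proved by pairing `h` with the Rademacher sum of
its own coefficients. -/
theorem sum_norm_sq_rademacher_mean_le (h : Finset ι → E) :
    ∑ i, ‖((2 : 𝕜) ^ Fintype.card ι)⁻¹ • ∑ A, rademacher 𝕜 A i • h A‖ ^ 2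
      ≤ ((2 : ℝ) ^ Fintype.card ι)⁻¹ * ∑ A, ‖h A‖ ^ 2 := by
  set N : ℝ := 2 ^ Fintype.card ι with hN
  have hNpos : 0 < N := by positivity
  set c : ι → E := fun i => ((2 : 𝕜) ^ Fintype.card ι)⁻¹ • ∑ A, rademacher 𝕜 A i • h A with hc
  have hcN (i : ι) : ∑ A, rademacher 𝕜 A i • h A = (N : 𝕜) • c i := by
    have : (N : 𝕜) = 2 ^ Fintype.card ι := by rw [hN]; norm_cast
    rw [this, smul_inv_smul₀ (pow_ne_zero _ two_ne_zero)]
  have h1 : ∑ A, RCLike.re (inner 𝕜 (h A) (∑ i, rademacher 𝕜 A i • c i))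
      = N * ∑ i, ‖c i‖ ^ 2 := by
    rw [← map_sum]
    simp_rw [inner_sum, inner_smul_right]
    rw [sum_comm]
    have (i : ι) : ∑ A, rademacher 𝕜 A i * inner 𝕜 (h A) (c i) = (N * ‖c i‖ ^ 2 : ℝ) := by
      calc _ = inner 𝕜 (∑ A, rademacher 𝕜 A i • h A) (c i) := by
            simp_rw [sum_inner, inner_smul_left, conj_rademacher]
        _ = _ := by
            rw [hcN, inner_smul_left, inner_self_eq_norm_sq_to_K]
            simp
    simp_rw [this]
    rw [map_sum, mul_sum]
    simp
  have h2 : ∑ A, ‖∑ i, rademacher 𝕜 A i • c i‖ ^ 2 = N * ∑ i, ‖c i‖ ^ 2 := by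
    simpa [hN] using sum_powerset_norm_sq (𝕜 := 𝕜) univ c
  have h3 : N * ∑ i, ‖c i‖ ^ 2
      ≤ ∑ A, (‖h A‖ ^ 2 + ‖∑ i, rademacher 𝕜 A i • c i‖ ^ 2) / 2 := by
    rw [← h1]
    refine sum_le_sum fun A _ => (re_inner_le_norm _ _).trans ?_
    nlinarith [sq_nonneg (‖h A‖ - ‖∑ i, rademacher 𝕜 A i • c i‖)]
  rw [← sum_div, sum_add_distrib, h2] at h3
  rw [inv_mul_eq_div, le_div_iff₀ hNpos]
  linarith

end Rademacher

/-! ### Scalar truncation and its quadratic error. -/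

section Truncation

variable {𝕜 : Type*} [RCLike 𝕜]

/-- A smooth bounded approximation of the identity near the origin. -/
noncomputable def softTrunc (z : 𝕜) : 𝕜 := ((4 / (4 + ‖z‖ ^ 2) : ℝ) : 𝕜) * z

theorem continuous_softTrunc : Continuous (softTrunc : 𝕜 → 𝕜) := by
  unfold softTrunc
  refine (RCLike.continuous_ofReal.comp ?_).mul continuous_id
  exact continuous_const.div (by fun_prop) fun z => by positivity

theorem norm_softTrunc (z : 𝕜) : ‖softTrunc z‖ = 4 / (4 + ‖z‖ ^ 2) * ‖z‖ := by
  rw [softTrunc, norm_mul, RCLike.norm_ofReal, abs_of_nonneg (by positivity)]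

theorem norm_softTrunc_le_one (z : 𝕜) : ‖softTrunc z‖ ≤ 1 := by
  rw [norm_softTrunc, div_mul_eq_mul_div, div_le_one (by positivity)]
  nlinarith [sq_nonneg (‖z‖ - 2)]

theorem norm_softTrunc_le (z : 𝕜) : ‖softTrunc z‖ ≤ ‖z‖ := by
  rw [norm_softTrunc]
  refine mul_le_of_le_one_left (norm_nonneg z) ?_
  rw [div_le_one (by positivity)]
  nlinarith [sq_nonneg ‖z‖]

theorem norm_sub_softTrunc_le (z : 𝕜) : ‖z - softTrunc z‖ ≤ ‖z‖ ^ 2 / 4 := by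
  have h : z - softTrunc z = ((‖z‖ ^ 2 / (4 + ‖z‖ ^ 2) : ℝ) : 𝕜) * z := by
    have : (‖z‖ ^ 2 / (4 + ‖z‖ ^ 2) : ℝ) = 1 - 4 / (4 + ‖z‖ ^ 2) := by field_simp; ring
    rw [this, softTrunc]
    push_cast
    ring
  rw [h, norm_mul, RCLike.norm_ofReal, abs_of_nonneg (by positivity), div_mul_eq_mul_div,
    div_le_div_iff₀ (by positivity) (by positivity)]
  nlinarith [mul_nonneg (sq_nonneg ‖z‖) (sq_nonneg (‖z‖ - 2))]

/-- By orthogonality the differences are the Rademacher coefficients of `g - softTrunc g`, of size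
at most `|g|² / 4`. Bessel and the fourth moment bound give the constant `3 / 16 ≤ 1 / 4`. -/
theorem sum_norm_sq_sub_mean_softTrunc_le {ι : Type*} [Fintype ι] [DecidableEq ι] (z : ι → 𝕜) :
    ∑ i, ‖z i - ((2 : 𝕜) ^ Fintype.card ι)⁻¹ *
        ∑ A, rademacher 𝕜 A i * softTrunc (∑ j, rademacher 𝕜 A j * z j)‖ ^ 2
      ≤ (∑ i, ‖z i‖ ^ 2) ^ 2 / 4 := by
  set g : Finset ι → 𝕜 := fun A => ∑ j, rademacher 𝕜 A j * z j with hg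
  have h1 (i : ι) : z i - ((2 : 𝕜) ^ Fintype.card ι)⁻¹ *
      ∑ A, rademacher 𝕜 A i * softTrunc (g A)
      = ((2 : 𝕜) ^ Fintype.card ι)⁻¹ • ∑ A, rademacher 𝕜 A i • (g A - softTrunc (g A)) := by
    have := sum_rademacher_smul_sum (𝕜 := 𝕜) z i
    simp only [smul_eq_mul] at this ⊢
    simp_rw [mul_sub]
    rw [Finset.sum_sub_distrib, mul_sub, this, inv_mul_cancel_left₀ (pow_ne_zero _ two_ne_zero)]
  change ∑ i, ‖z i - ((2 : 𝕜) ^ Fintype.card ι)⁻¹ *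
    ∑ A, rademacher 𝕜 A i * softTrunc (g A)‖ ^ 2 ≤ _
  simp_rw [h1]
  refine (sum_norm_sq_rademacher_mean_le _).trans ?_
  have h2 : ∑ A, ‖g A - softTrunc (g A)‖ ^ 2 ≤ ∑ A, ‖g A‖ ^ 4 / 16 := by
    refine Finset.sum_le_sum fun A _ => ?_
    have := pow_le_pow_left₀ (norm_nonneg _) (norm_sub_softTrunc_le (g A)) 2
    exact this.trans_eq (by ring)
  have h3 : ∑ A, ‖g A‖ ^ 4 ≤ 2 ^ Fintype.card ι * (3 * (∑ i, ‖z i‖ ^ 2) ^ 2) := by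
    simpa [hg] using sum_powerset_norm_pow_four_le (𝕜 := 𝕜) Finset.univ z
  rw [← Finset.sum_div] at h2
  rw [inv_mul_eq_div, div_le_iff₀ (by positivity)]
  have : (0 : ℝ) ≤ 2 ^ Fintype.card ι * (∑ i, ‖z i‖ ^ 2) ^ 2 := by positivity
  nlinarith

end Truncation

theorem exists_signs_sum_norm_sq_le {𝕜 : Type*} [RCLike 𝕜] {E : Type*} [NormedAddCommGroup E]
    [InnerProductSpace 𝕜 E] {ι : Type*} [DecidableEq ι] (S : Finset ι) (z : ι → E) :
    ∃ A : Finset ι, ∑ i ∈ S, ‖z i‖ ^ 2 ≤ ‖∑ i ∈ S, rademacher 𝕜 A i • z i‖ ^ 2 := by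
  by_contra! h
  have h1 := sum_powerset_norm_sq (𝕜 := 𝕜) S z
  have h2 := Finset.sum_lt_sum_of_nonempty (Finset.powerset_nonempty S) fun A _ => h A
  rw [h1] at h2
  simp at h2

/-! ### Norms in `L_2` and `L_∞`. -/

section Lp

variable {𝕜 : Type*} [RCLike 𝕜] {α : Type*} [MeasurableSpace α] {μ : Measure α}

theorem MeasureTheory.L2.norm_sq_eq_integral (f : Lp 𝕜 2 μ) : ‖f‖ ^ 2 = ∫ t, ‖f t‖ ^ 2 ∂μ := by
  have h := inner_self_eq_norm_sq (𝕜 := 𝕜) f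
  rw [L2.inner_def, ← integral_re (L2.integrable_inner f f)] at h
  rw [← h]
  exact integral_congr_ae (.of_forall fun t => inner_self_eq_norm_sq (𝕜 := 𝕜) (f t))

theorem MeasureTheory.L2.integrable_norm_sq (f : Lp 𝕜 2 μ) : Integrable (fun t => ‖f t‖ ^ 2) μ :=
  (Lp.memLp f).integrable_norm_pow two_ne_zero

theorem MeasureTheory.Lp.norm_top_le_of_ae_bound {f : Lp 𝕜 ∞ μ} {C : ℝ} (hC : 0 ≤ C)
    (h : ∀ᵐ t ∂μ, ‖f t‖ ≤ C) : ‖f‖ ≤ C := by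
  rw [Lp.norm_def, eLpNorm_exponent_top]
  exact ENNReal.toReal_le_of_le_ofReal hC (eLpNormEssSup_le_of_ae_bound h)

theorem MeasureTheory.Lp.ae_norm_le_norm_top (f : Lp 𝕜 ∞ μ) : ∀ᵐ t ∂μ, ‖f t‖ ≤ ‖f‖ := by
  filter_upwards [ae_le_eLpNormEssSup (f := f) (μ := μ)] with t ht
  rw [← eLpNorm_exponent_top, ← Lp.enorm_def] at ht
  exact NNReal.coe_le_coe.2 (by simpa [enorm_eq_nnnorm] using ht)

end Lp

/-! ### Truncation in the intersection space. -/

namespace LpInter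

variable {𝕜 : Type*} [RCLike 𝕜] {α : Type*} [MeasurableSpace α] {p q : ℝ≥0∞} {μ : Measure α}

/-- The inclusion of `L_p ∩ L_q` in `L_p`. -/
def fst : LpInter 𝕜 p q μ →ₗ[𝕜] Lp 𝕜 p μ where
  toFun y := ⟨y, y.2.1⟩
  map_add' _ _ := rfl
  map_smul' _ _ := rfl

/-- The inclusion of `L_p ∩ L_q` in `L_q`. -/
def snd : LpInter 𝕜 p q μ →ₗ[𝕜] Lp 𝕜 q μ where
  toFun y := ⟨y, y.2.2⟩
  map_add' _ _ := rfl
  map_smul' _ _ := rfl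

theorem norm_fst_le (y : LpInter 𝕜 p q μ) : ‖fst y‖ ≤ ‖y‖ := le_max_left _ _

theorem norm_snd_le (y : LpInter 𝕜 p q μ) : ‖snd y‖ ≤ ‖y‖ := le_max_right _ _

theorem ae_norm_le (y : LpInter 𝕜 p ∞ μ) : ∀ᵐ t ∂μ, ‖(y : α →ₘ[μ] 𝕜) t‖ ≤ ‖y‖ := by
  filter_upwards [Lp.ae_norm_le_norm_top (snd y)] with t ht
  exact ht.trans (norm_snd_le y)

theorem norm_le_of_ae_bound {y : LpInter 𝕜 p ∞ μ} {C : ℝ} (hC : 0 ≤ C) (h1 : ‖fst y‖ ≤ C)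
    (h2 : ∀ᵐ t ∂μ, ‖(y : α →ₘ[μ] 𝕜) t‖ ≤ C) : ‖y‖ ≤ C :=
  max_le h1 (Lp.norm_top_le_of_ae_bound (f := snd y) hC h2)

theorem coeFn_sum_smul {ι : Type*} (S : Finset ι) (c : ι → 𝕜) (y : ι → LpInter 𝕜 p q μ) :
    ((∑ i ∈ S, c i • y i : LpInter 𝕜 p q μ) : α →ₘ[μ] 𝕜)
      =ᵐ[μ] fun t => ∑ i ∈ S, c i * (y i : α →ₘ[μ] 𝕜) t := by
  classical
  induction S using Finset.induction_on with
  | empty =>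
    simp only [Finset.sum_empty]
    exact AEEqFun.coeFn_zero
  | insert a S ha ih =>
    simp only [Finset.sum_insert ha]
    filter_upwards [ih, AEEqFun.coeFn_add ((c a • y a : LpInter 𝕜 p q μ) : α →ₘ[μ] 𝕜)
      (∑ i ∈ S, c i • y i : LpInter 𝕜 p q μ),
      AEEqFun.coeFn_smul (c a) (y a : α →ₘ[μ] 𝕜)] with t h1 h2 h3
    rw [← h1]
    refine h2.trans ?_
    rw [Pi.add_apply]
    exact congrArg (· + _) h3

/-- The truncation `softTrunc` acting on `L_p ∩ L_q`. -/
noncomputable def trunc (y : LpInter 𝕜 p q μ) : LpInter 𝕜 p q μ := by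
  have h : ∀ᵐ t ∂μ, ‖AEEqFun.comp softTrunc continuous_softTrunc (y : α →ₘ[μ] 𝕜) t‖
      ≤ ‖(y : α →ₘ[μ] 𝕜) t‖ := by
    filter_upwards [AEEqFun.coeFn_comp softTrunc continuous_softTrunc (y : α →ₘ[μ] 𝕜)] with t ht
    rw [ht]
    exact norm_softTrunc_le _
  exact ⟨AEEqFun.comp softTrunc continuous_softTrunc y,
    (eLpNorm_mono_ae h).trans_lt y.2.1, (eLpNorm_mono_ae h).trans_lt y.2.2⟩

theorem coeFn_trunc (y : LpInter 𝕜 p q μ) :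
    (trunc y : α →ₘ[μ] 𝕜) =ᵐ[μ] fun t => softTrunc ((y : α →ₘ[μ] 𝕜) t) :=
  AEEqFun.coeFn_comp softTrunc continuous_softTrunc _

theorem norm_fst_trunc_le (y : LpInter 𝕜 p q μ) : ‖fst (trunc y)‖ ≤ ‖fst y‖ := by
  refine Lp.norm_le_norm_of_ae_le ?_
  filter_upwards [coeFn_trunc y] with t ht
  exact (congrArg norm ht).trans_le (norm_softTrunc_le _)

theorem norm_trunc_le_one {y : LpInter 𝕜 p ∞ μ} (hy : ‖fst y‖ ≤ 1) : ‖trunc y‖ ≤ 1 := by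
  refine norm_le_of_ae_bound zero_le_one ((norm_fst_trunc_le y).trans hy) ?_
  filter_upwards [coeFn_trunc y] with t ht
  exact (congrArg norm ht).trans_le (norm_softTrunc_le_one _)

/-! ### The Grothendieck-type trace estimate. -/

section Trace

variable {ι : Type*} [Fintype ι]

/-- Finite families in `L_2 ∩ L_∞` whose square function is bounded by one and is small
in `L_2`. -/
def SmallSquare (f : ι → LpInter 𝕜 2 ∞ μ) : Prop :=
  (∀ᵐ t ∂μ, ∑ i, ‖(f i : α →ₘ[μ] 𝕜) t‖ ^ 2 ≤ 1) ∧ Fintype.card ι * ∑ i, ‖fst (f i)‖ ^ 2 ≤ 1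

theorem SmallSquare.norm_le_one {f : ι → LpInter 𝕜 2 ∞ μ} (hf : SmallSquare f) (i : ι) :
    ‖f i‖ ≤ 1 := by
  refine norm_le_of_ae_bound zero_le_one ?_ ?_
  · have h1 : ‖fst (f i)‖ ^ 2 ≤ ∑ i, ‖fst (f i)‖ ^ 2 :=
      Finset.single_le_sum (f := fun i => ‖fst (f i)‖ ^ 2) (fun _ _ => sq_nonneg _)
        (Finset.mem_univ i)
    have h2 : (1 : ℝ) ≤ Fintype.card ι := by
      exact_mod_cast Fintype.card_pos_iff.2 ⟨i⟩
    have h3 := hf.2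
    have h4 := sq_nonneg ‖fst (f i)‖
    have : ‖fst (f i)‖ ^ 2 ≤ 1 := by nlinarith
    exact (sq_le_one_iff₀ (norm_nonneg _)).1 this
  · filter_upwards [hf.1] with t ht
    have h1 := Finset.single_le_sum (f := fun i => ‖(f i : α →ₘ[μ] 𝕜) t‖ ^ 2)
      (fun _ _ => sq_nonneg _) (Finset.mem_univ i)
    exact (sq_le_one_iff₀ (norm_nonneg _)).1 (h1.trans ht)

theorem sum_norm_sq_fst_eq_integral (f : ι → LpInter 𝕜 2 ∞ μ) :
    ∑ i, ‖fst (f i)‖ ^ 2 = ∫ t, ∑ i, ‖(f i : α →ₘ[μ] 𝕜) t‖ ^ 2 ∂μ := by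
  refine Eq.trans ?_ (integral_finsetSum _ fun i _ => L2.integrable_norm_sq (fst (f i))).symm
  exact Finset.sum_congr rfl fun i _ => L2.norm_sq_eq_integral (fst (f i))

variable [DecidableEq ι]

/-- Cauchy–Schwarz uses up the factor `Fintype.card ι` in `SmallSquare`. Truncation need then only
control the sup norm of the signed sums. -/
theorem SmallSquare.norm_fst_sum_le_one {f : ι → LpInter 𝕜 2 ∞ μ} (hf : SmallSquare f)
    (A : Finset ι) : ‖fst (∑ i, rademacher 𝕜 A i • f i)‖ ≤ 1 := by
  rw [map_sum]
  have h1 : ‖∑ i, fst (rademacher 𝕜 A i • f i)‖ ≤ ∑ i, ‖fst (f i)‖ := by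
    refine (norm_sum_le _ _).trans_eq (Finset.sum_congr rfl fun i _ => ?_)
    rw [map_smul, norm_smul, norm_rademacher, one_mul]
  have h2 : (∑ i, ‖fst (f i)‖) ^ 2 ≤ Fintype.card ι * ∑ i, ‖fst (f i)‖ ^ 2 := by
    simpa using sq_sum_le_card_mul_sum_sq (s := Finset.univ) (f := fun i => ‖fst (f i)‖)
  refine h1.trans ((sq_le_one_iff₀ ?_).1 (h2.trans hf.2))
  positivity

/-- The error made when a family is recovered from the truncations of its Rademacher sums. -/
noncomputable def truncError (f : ι → LpInter 𝕜 2 ∞ μ) (i : ι) : LpInter 𝕜 2 ∞ μ :=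
  f i - ((2 : 𝕜) ^ Fintype.card ι)⁻¹ •
    ∑ A, rademacher 𝕜 A i • trunc (∑ j, rademacher 𝕜 A j • f j)

theorem ae_sum_norm_sq_truncError_le (f : ι → LpInter 𝕜 2 ∞ μ) :
    ∀ᵐ t ∂μ, ∑ i, ‖(truncError f i : α →ₘ[μ] 𝕜) t‖ ^ 2
      ≤ (∑ i, ‖(f i : α →ₘ[μ] 𝕜) t‖ ^ 2) ^ 2 / 4 := by
  have h1 : ∀ᵐ t ∂μ, ∀ A, (trunc (∑ j, rademacher 𝕜 A j • f j) : α →ₘ[μ] 𝕜) t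
      = softTrunc (∑ j, rademacher 𝕜 A j * (f j : α →ₘ[μ] 𝕜) t) := by
    refine ae_all_iff.2 fun A => ?_
    filter_upwards [coeFn_trunc (∑ j, rademacher 𝕜 A j • f j),
      coeFn_sum_smul Finset.univ (rademacher 𝕜 A) f] with t h1 h2
    rw [h1, h2]
  have h2 : ∀ᵐ t ∂μ, ∀ i, (truncError f i : α →ₘ[μ] 𝕜) t = (f i : α →ₘ[μ] 𝕜) t -
      ((2 : 𝕜) ^ Fintype.card ι)⁻¹ * ∑ A, rademacher 𝕜 A i *
        (trunc (∑ j, rademacher 𝕜 A j • f j) : α →ₘ[μ] 𝕜) t := by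
    refine ae_all_iff.2 fun i => ?_
    set w := ∑ A, rademacher 𝕜 A i • trunc (∑ j, rademacher 𝕜 A j • f j) with hw
    filter_upwards [coeFn_sum_smul Finset.univ (fun A => rademacher 𝕜 A i)
        fun A => trunc (∑ j, rademacher 𝕜 A j • f j),
      AEEqFun.coeFn_sub (f i : α →ₘ[μ] 𝕜)
        ((((2 : 𝕜) ^ Fintype.card ι)⁻¹ • w : LpInter 𝕜 2 ∞ μ) : α →ₘ[μ] 𝕜),
      AEEqFun.coeFn_smul ((2 : 𝕜) ^ Fintype.card ι)⁻¹ (w : α →ₘ[μ] 𝕜)] with t h1 h2 h3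
    rw [← h1]
    refine h2.trans ?_
    rw [Pi.sub_apply]
    exact congrArg (_ - ·) h3
  filter_upwards [h1, h2] with t h1 h2
  simp_rw [h2, h1]
  exact sum_norm_sq_sub_mean_softTrunc_le _

theorem SmallSquare.two_smul_truncError {f : ι → LpInter 𝕜 2 ∞ μ} (hf : SmallSquare f) :
    SmallSquare fun i => (2 : 𝕜) • truncError f i := by
  have key : ∀ᵐ t ∂μ, ∑ i, ‖((2 : 𝕜) • truncError f i : LpInter 𝕜 2 ∞ μ).1 t‖ ^ 2
      ≤ (∑ i, ‖(f i : α →ₘ[μ] 𝕜) t‖ ^ 2) ^ 2 := by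
    have h : ∀ᵐ t ∂μ, ∀ i, ((2 : 𝕜) • truncError f i : LpInter 𝕜 2 ∞ μ).1 t
        = 2 * (truncError f i : α →ₘ[μ] 𝕜) t :=
      ae_all_iff.2 fun i => AEEqFun.coeFn_smul (2 : 𝕜) (truncError f i : α →ₘ[μ] 𝕜)
    filter_upwards [h, ae_sum_norm_sq_truncError_le f] with t h1 h2
    simp_rw [h1, norm_mul, mul_pow, ← Finset.mul_sum]
    rw [RCLike.norm_ofNat]
    linarith
  refine ⟨?_, le_trans ?_ hf.2⟩
  · filter_upwards [key, hf.1] with t h1 h2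
    exact h1.trans (pow_le_one₀ (Finset.sum_nonneg fun _ _ => sq_nonneg _) h2)
  · gcongr ?_ * ?_
    rw [sum_norm_sq_fst_eq_integral, sum_norm_sq_fst_eq_integral]
    refine integral_mono_ae (integrable_finsetSum _ fun i _ =>
      L2.integrable_norm_sq (fst ((2 : 𝕜) • truncError f i)))
      (integrable_finsetSum _ fun i _ => L2.integrable_norm_sq (fst (f i))) ?_
    filter_upwards [key, hf.1] with t h1 h2
    refine h1.trans ?_
    -- The square function is at most 1, so squaring it does not increase its integral.
    exact pow_le_of_le_one (Finset.sum_nonneg fun _ _ => sq_nonneg _) h2 two_ne_zero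

/-- A form of Grothendieck's theorem: the trace of a finite rank operator that factors through
the part of `L_2 ∩ L_∞` with small `L_2`-norms. -/
theorem SmallSquare.norm_sum_apply_le {ψ : ι → LpInter 𝕜 2 ∞ μ →ₗ[𝕜] 𝕜} {D : ℝ} (hD : 0 ≤ D)
    (hψ : ∀ y, ∑ i, ‖ψ i y‖ ≤ D * ‖y‖) {f : ι → LpInter 𝕜 2 ∞ μ} (hf : SmallSquare f) :
    ‖∑ i, ψ i (f i)‖ ≤ 2 * D := by
  set V : Set ℝ := {r | ∃ f : ι → LpInter 𝕜 2 ∞ μ, SmallSquare f ∧ r = ‖∑ i, ψ i (f i)‖} with hV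
  -- A crude bound suffices, but finiteness is needed to absorb `sSup V / 2`.
  have hbdd : BddAbove V := by
    refine ⟨∑ _i : ι, D, ?_⟩
    rintro r ⟨f, hf, rfl⟩
    refine (norm_sum_le _ _).trans (Finset.sum_le_sum fun i _ => ?_)
    refine (Finset.single_le_sum (f := fun j => ‖ψ j (f i)‖) (fun _ _ => norm_nonneg _)
      (Finset.mem_univ i)).trans ((hψ (f i)).trans ?_)
    exact mul_le_of_le_one_right hD (hf.norm_le_one i)
  have hstep : sSup V ≤ D + sSup V / 2 := by
    refine csSup_le ⟨_, f, hf, rfl⟩ ?_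
    rintro r ⟨f, hf, rfl⟩
    set N : 𝕜 := 2 ^ Fintype.card ι with hN
    set G : Finset ι → LpInter 𝕜 2 ∞ μ := fun A => trunc (∑ j, rademacher 𝕜 A j • f j) with hG
    have h1 : ∑ i, ψ i (f i) = N⁻¹ * ∑ A, ∑ i, rademacher 𝕜 A i * ψ i (G A)
        + 2⁻¹ * ∑ i, ψ i ((2 : 𝕜) • truncError f i) := by
      rw [Finset.sum_comm, Finset.mul_sum, Finset.mul_sum, ← Finset.sum_add_distrib]
      refine Finset.sum_congr rfl fun i _ => ?_
      rw [map_smul, smul_eq_mul, inv_mul_cancel_left₀ two_ne_zero, truncError, map_sub, map_smul,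
        map_sum]
      simp_rw [map_smul, smul_eq_mul]
      ring
    have h2 : ‖N⁻¹ * ∑ A, ∑ i, rademacher 𝕜 A i * ψ i (G A)‖ ≤ D := by
      rw [norm_mul, norm_inv, hN, norm_pow, RCLike.norm_ofNat, inv_mul_le_iff₀ (by positivity)]
      refine (norm_sum_le_of_le (n := fun _ => D) _ fun A _ => ?_).trans_eq ?_
      · refine (norm_sum_le _ _).trans ?_
        simp_rw [norm_mul, norm_rademacher, one_mul]
        exact (hψ _).trans (mul_le_of_le_one_right hD (norm_trunc_le_one (hf.norm_fst_sum_le_one A)))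
      · simp
    have h3 : ‖(2 : 𝕜)⁻¹ * ∑ i, ψ i ((2 : 𝕜) • truncError f i)‖ ≤ sSup V / 2 := by
      rw [norm_mul, norm_inv, RCLike.norm_ofNat, inv_mul_eq_div]
      exact div_le_div_of_nonneg_right (le_csSup hbdd ⟨_, hf.two_smul_truncError, rfl⟩) zero_le_two
    rw [h1]
    exact (norm_add_le _ _).trans (add_le_add h2 h3)
  have := le_csSup hbdd ⟨f, hf, rfl⟩
  linarith

end Trace

end LpInter

/-! ### From norm estimates to the square function. -/

section Pointwise

variable {𝕜 : Type*} [RCLike 𝕜] {α : Type*} [MeasurableSpace α] {p : ℝ≥0∞} {μ : Measure α}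

/-- A countable dense set of coefficients gives one null set valid for all `a`; off it, `a` may
depend on `t` and is taken to be the conjugate of the values at `t`. -/
theorem LpInter.ae_sum_norm_sq_le_one {ι : Type*} [Fintype ι] {f : ι → LpInter 𝕜 p ∞ μ}
    (hf : ∀ a : ι → 𝕜, ‖∑ i, a i • f i‖ ^ 2 ≤ ∑ i, ‖a i‖ ^ 2) :
    ∀ᵐ t ∂μ, ∑ i, ‖(f i : α →ₘ[μ] 𝕜) t‖ ^ 2 ≤ 1 := by
  have h : ∀ᵐ t ∂μ, ∀ k : ℕ, ‖∑ i, TopologicalSpace.denseSeq (ι → 𝕜) k i *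
      (f i : α →ₘ[μ] 𝕜) t‖ ^ 2 ≤ ∑ i, ‖TopologicalSpace.denseSeq (ι → 𝕜) k i‖ ^ 2 := by
    refine ae_all_iff.2 fun k => ?_
    set a := TopologicalSpace.denseSeq (ι → 𝕜) k
    filter_upwards [coeFn_sum_smul Finset.univ a f, ae_norm_le (∑ i, a i • f i)] with t h1 h2
    rw [← h1]
    exact (pow_le_pow_left₀ (norm_nonneg _) h2 2).trans (hf a)
  filter_upwards [h] with t ht
  have hall : ∀ a : ι → 𝕜, ‖∑ i, a i * (f i : α →ₘ[μ] 𝕜) t‖ ^ 2 ≤ ∑ i, ‖a i‖ ^ 2 := by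
    intro a
    have hcl : IsClosed {a : ι → 𝕜 | ‖∑ i, a i * (f i : α →ₘ[μ] 𝕜) t‖ ^ 2 ≤ ∑ i, ‖a i‖ ^ 2} :=
      isClosed_le (by fun_prop) (by fun_prop)
    have hsub := hcl.closure_subset_iff.2 (Set.range_subset_iff.2 ht)
    rw [(TopologicalSpace.denseRange_denseSeq (ι → 𝕜)).closure_range] at hsub
    exact hsub (Set.mem_univ a)
  have h1 := hall fun i => (starRingEnd 𝕜) ((f i : α →ₘ[μ] 𝕜) t)
  simp_rw [RCLike.conj_mul, RCLike.norm_conj] at h1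
  set S := ∑ i, ‖(f i : α →ₘ[μ] 𝕜) t‖ ^ 2 with hS
  have hS0 : 0 ≤ S := Finset.sum_nonneg fun _ _ => sq_nonneg _
  have h2 : ∑ i, (‖(f i : α →ₘ[μ] 𝕜) t‖ : 𝕜) ^ 2 = (S : 𝕜) := by
    rw [hS]; push_cast; rfl
  rw [h2, RCLike.norm_ofReal, sq_abs] at h1
  by_contra! hlt
  nlinarith

end Pointwise

/-! ### Inclusions and integrals on the sum space. -/

namespace LpSum

variable {𝕜 : Type*} [RCLike 𝕜] {α : Type*} [MeasurableSpace α] {p q : ℝ≥0∞} {μ : Measure α}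

/-- The inclusion of `L_p` in `L_p + L_q`. -/
def inl : Lp 𝕜 p μ →ₗ[𝕜] LpSum 𝕜 p q μ where
  toFun u := ⟨u, Submodule.mem_sup_left u.2⟩
  map_add' _ _ := rfl
  map_smul' _ _ := rfl

/-- The inclusion of `L_q` in `L_p + L_q`. -/
def inr : Lp 𝕜 q μ →ₗ[𝕜] LpSum 𝕜 p q μ where
  toFun v := ⟨v, Submodule.mem_sup_right v.2⟩
  map_add' _ _ := rfl
  map_smul' _ _ := rfl

theorem norm_inl_le [Fact (1 ≤ q)] (u : Lp 𝕜 p μ) : ‖(inl u : LpSum 𝕜 p q μ)‖ ≤ ‖u‖ := by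
  simpa using norm_le (inl u : LpSum 𝕜 p q μ) u 0 (by simp [inl])

theorem norm_inr_le [Fact (1 ≤ p)] (v : Lp 𝕜 q μ) : ‖(inr v : LpSum 𝕜 p q μ)‖ ≤ ‖v‖ := by
  simpa using norm_le (inr v : LpSum 𝕜 p q μ) 0 v (by simp [inr])

variable [Fact (1 ≤ p)] [Fact (1 ≤ q)]

theorem integrableOn (x : LpSum 𝕜 p q μ) {s : Set α} (hs : μ s ≠ ∞) :
    IntegrableOn (x : α →ₘ[μ] 𝕜) s μ := by
  obtain ⟨u, hu, v, hv, h⟩ := Submodule.mem_sup.1 x.2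
  have h1 := integrableOn_Lp_of_measure_ne_top (⟨u, hu⟩ : Lp 𝕜 p μ) (Fact.out : 1 ≤ p) hs
  have h2 := integrableOn_Lp_of_measure_ne_top (⟨v, hv⟩ : Lp 𝕜 q μ) (Fact.out : 1 ≤ q) hs
  refine (h1.add h2).congr (ae_restrict_of_ae ?_)
  rw [← h]
  exact (AEEqFun.coeFn_add u v).symm

/-- Integration over a set of finite measure. -/
noncomputable def setIntegral (s : Set α) (hs : μ s ≠ ∞) : LpSum 𝕜 p q μ →ₗ[𝕜] 𝕜 where
  toFun x := ∫ t in s, (x : α →ₘ[μ] 𝕜) t ∂μ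
  map_add' x y := by
    rw [← integral_add (LpSum.integrableOn x hs) (LpSum.integrableOn y hs)]
    exact integral_congr_ae (ae_restrict_of_ae (AEEqFun.coeFn_add x.1 y.1))
  map_smul' c x := by
    rw [RingHom.id_apply, ← integral_smul]
    exact integral_congr_ae (ae_restrict_of_ae (AEEqFun.coeFn_smul c x.1))

end LpSum

/-! ### Equal cells and the distortion bound. -/

/-- A disjoint family of measurable sets of measure `1 / n`. -/
structure EqualCells {α ι : Type*} [MeasurableSpace α] (μ : Measure α) (n : ℕ) (s : ι → Set α) :
    Prop where
  measurableSet : ∀ i, MeasurableSet (s i)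
  disjoint : Pairwise fun i j => Disjoint (s i) (s j)
  measure_eq : ∀ i, μ (s i) = (n : ℝ≥0∞)⁻¹

namespace EqualCells

variable {α ι : Type*} [MeasurableSpace α] {μ : Measure α} {n : ℕ} {s : ι → Set α}

theorem comp {κ : Type*} (h : EqualCells μ n s) {e : κ → ι} (he : Function.Injective e) :
    EqualCells μ n fun k => s (e k) where
  measurableSet k := h.measurableSet (e k)
  disjoint _ _ hkl := h.disjoint (he.ne hkl)
  measure_eq k := h.measure_eq (e k)

theorem measureReal_eq (h : EqualCells μ n s) (i : ι) : μ.real (s i) = (n : ℝ)⁻¹ := by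
  simp [Measure.real, h.measure_eq i]

variable [NeZero n]

theorem measure_ne_top (h : EqualCells μ n s) (i : ι) : μ (s i) ≠ ∞ := by
  rw [h.measure_eq]
  simp [NeZero.ne n]

variable (𝕜 : Type*) [RCLike 𝕜]

/-- The indicator of a cell in `L_p`. -/
noncomputable def indLp (p : ℝ≥0∞) (h : EqualCells μ n s) (i : ι) : Lp 𝕜 p μ :=
  indicatorConstLp p (h.measurableSet i) (h.measure_ne_top i) 1

/-- The indicator of a cell in `L_2 + L_∞`. -/
noncomputable def ind (h : EqualCells μ n s) (i : ι) : LpSum 𝕜 2 ∞ μ := LpSum.inl (h.indLp 𝕜 2 i)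

theorem ind_eq_inr (h : EqualCells μ n s) (i : ι) : h.ind 𝕜 i = LpSum.inr (h.indLp 𝕜 ∞ i) := rfl

theorem orthonormal (h : EqualCells μ n s) :
    Orthonormal 𝕜 fun i => ((√(n : ℝ) : ℝ) : 𝕜) • h.indLp 𝕜 2 i := by
  classical
  rw [orthonormal_iff_ite]
  intro i j
  rw [inner_smul_left, inner_smul_right, indLp, indLp,
    L2.inner_indicatorConstLp_one_indicatorConstLp_one (h.measurableSet i) (h.measurableSet j)
      (h.measure_ne_top i) (h.measure_ne_top j)]
  split_ifs with hij
  · subst hij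
    rw [Set.inter_self, h.measureReal_eq, RCLike.conj_ofReal, ← mul_assoc, ← RCLike.ofReal_mul,
      Real.mul_self_sqrt (Nat.cast_nonneg n), ← RCLike.ofReal_mul,
      mul_inv_cancel₀ (Nat.cast_ne_zero.2 (NeZero.ne n)), RCLike.ofReal_one]
  · rw [(h.disjoint hij).inter_eq]
    simp

variable {𝕜}

theorem norm_sum_smul_ind_sq_le [Fintype ι] (h : EqualCells μ n s) (a : ι → 𝕜) :
    ‖∑ i, a i • h.ind 𝕜 i‖ ^ 2 ≤ (n : ℝ)⁻¹ * ∑ i, ‖a i‖ ^ 2 := by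
  have hn : 0 < (n : ℝ) := by exact_mod_cast Nat.pos_of_ne_zero (NeZero.ne n)
  have h1 : ‖∑ i, a i • h.ind 𝕜 i‖ ≤ ‖∑ i, a i • h.indLp 𝕜 2 i‖ := by
    have : ∑ i, a i • h.ind 𝕜 i = LpSum.inl (∑ i, a i • h.indLp 𝕜 2 i) := by
      simp [ind]
    rw [this]
    exact LpSum.norm_inl_le _
  refine (pow_le_pow_left₀ (norm_nonneg _) h1 2).trans ?_
  have h2 : ‖∑ i, a i • (((√(n : ℝ) : ℝ) : 𝕜) • h.indLp 𝕜 2 i)‖ ^ 2 = ∑ i, ‖a i‖ ^ 2 := by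
    rw [← inner_self_eq_norm_sq (𝕜 := 𝕜), (h.orthonormal 𝕜).inner_sum, map_sum]
    refine Finset.sum_congr rfl fun i _ => ?_
    rw [RCLike.conj_mul]
    norm_cast
  have h3 : ∑ i, a i • (((√(n : ℝ) : ℝ) : 𝕜) • h.indLp 𝕜 2 i)
      = ((√(n : ℝ) : ℝ) : 𝕜) • ∑ i, a i • h.indLp 𝕜 2 i := by
    rw [Finset.smul_sum]
    exact Finset.sum_congr rfl fun i _ => smul_comm _ _ _
  rw [h3, norm_smul, mul_pow, RCLike.norm_ofReal, sq_abs, Real.sq_sqrt hn.le] at h2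
  rw [← h2, inv_mul_cancel_left₀ hn.ne']

theorem norm_sum_rademacher_smul_ind_le_one [DecidableEq ι] (h : EqualCells μ n s)
    (A G : Finset ι) : ‖∑ i ∈ G, rademacher 𝕜 A i • h.ind 𝕜 i‖ ≤ 1 := by
  have h1 : ∑ i ∈ G, rademacher 𝕜 A i • h.ind 𝕜 i
      = LpSum.inr (∑ i ∈ G, rademacher 𝕜 A i • h.indLp 𝕜 ∞ i) := by
    simp [ind_eq_inr]
  rw [h1]
  refine (LpSum.norm_inr_le _).trans (Lp.norm_top_le_of_ae_bound zero_le_one ?_)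
  have h2 : ∀ᵐ t ∂μ, ∀ i ∈ G, (rademacher 𝕜 A i • h.indLp 𝕜 ∞ i) t
      = rademacher 𝕜 A i * (s i).indicator (fun _ => 1) t := by
    refine (ae_ball_iff G.countable_toSet).2 fun i _ => ?_
    filter_upwards [Lp.coeFn_smul (rademacher 𝕜 A i) (h.indLp 𝕜 ∞ i),
      indicatorConstLp_coeFn (p := ∞) (hs := h.measurableSet i) (hμs := h.measure_ne_top i)
        (c := (1 : 𝕜))] with t h1 h2
    rw [h1, Pi.smul_apply, smul_eq_mul, ← h2]
    rfl
  filter_upwards [h2, Lp.coeFn_finsetSum G fun i => rademacher 𝕜 A i • h.indLp 𝕜 ∞ i]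
    with t h2 h3
  rw [h3, Finset.sum_apply, Finset.sum_congr rfl h2]
  by_cases ht : ∃ i ∈ G, t ∈ s i
  · obtain ⟨i, hi, hti⟩ := ht
    rw [Finset.sum_eq_single i]
    · simp [hti, norm_rademacher]
    · intro j _ hji
      have : t ∉ s j := fun htj => Set.disjoint_left.1 (h.disjoint hji) htj hti
      simp [this]
    · exact fun hi' => absurd hi hi'
  · push Not at ht
    rw [Finset.sum_eq_zero]
    · simp
    · intro i hi
      simp [ht i hi]

/-- The cells have total measure at most 1: the `L_2` part is bounded by Bessel and Cauchy–Schwarz,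
the `L_∞` part cell by cell. -/
theorem sum_norm_setIntegral_le [Fintype ι] (hcard : Fintype.card ι ≤ n) (h : EqualCells μ n s)
    (x : LpSum 𝕜 2 ∞ μ) : ∑ i, ‖LpSum.setIntegral (s i) (h.measure_ne_top i) x‖ ≤ ‖x‖ := by
  have hn : 0 < (n : ℝ) := by exact_mod_cast Nat.pos_of_ne_zero (NeZero.ne n)
  have hcard' : (Fintype.card ι : ℝ) ≤ n := by exact_mod_cast hcard
  refine le_of_forall_pos_le_add fun ε hε => ?_
  obtain ⟨u, v, hx, hlt⟩ := LpSum.exists_lt x (lt_add_of_pos_right ‖x‖ hε)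
  have hsplit : x = LpSum.inl u + LpSum.inr v := Subtype.ext hx
  have hu : ∑ i, ‖LpSum.setIntegral (s i) (h.measure_ne_top i) (LpSum.inl u : LpSum 𝕜 2 ∞ μ)‖
      ≤ ‖u‖ := by
    have h1 (i : ι) : LpSum.setIntegral (s i) (h.measure_ne_top i) (LpSum.inl u : LpSum 𝕜 2 ∞ μ)
        = inner 𝕜 (h.indLp 𝕜 2 i) u := (L2.inner_indicatorConstLp_one _ _ u).symm
    have h2 := (h.orthonormal 𝕜).sum_inner_products_le u (s := Finset.univ)
    simp_rw [inner_smul_left, norm_mul, mul_pow, RCLike.norm_conj, RCLike.norm_ofReal, sq_abs,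
      Real.sq_sqrt hn.le, ← Finset.mul_sum] at h2
    simp_rw [h1]
    refine abs_le_of_sq_le_sq' ?_ (norm_nonneg u) |>.2
    refine le_trans ?_ h2
    refine (sq_sum_le_card_mul_sum_sq (s := Finset.univ)).trans ?_
    rw [Finset.card_univ]
    gcongr
  have hv : ∑ i, ‖LpSum.setIntegral (s i) (h.measure_ne_top i) (LpSum.inr v : LpSum 𝕜 2 ∞ μ)‖
      ≤ ‖v‖ := by
    have h1 (i : ι) : ‖LpSum.setIntegral (s i) (h.measure_ne_top i)
        (LpSum.inr v : LpSum 𝕜 2 ∞ μ)‖ ≤ ‖v‖ * (n : ℝ)⁻¹ := by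
      rw [← h.measureReal_eq i]
      refine norm_setIntegral_le_of_norm_le_const_ae (h.measure_ne_top i).lt_top ?_
      exact ae_restrict_of_ae (Lp.ae_norm_le_norm_top v)
    refine (Finset.sum_le_sum fun i _ => h1 i).trans ?_
    rw [Finset.sum_const, Finset.card_univ, nsmul_eq_mul]
    calc (Fintype.card ι : ℝ) * (‖v‖ * (n : ℝ)⁻¹) ≤ n * (‖v‖ * (n : ℝ)⁻¹) := by gcongr
      _ = ‖v‖ := by field_simp
  calc _ ≤ ∑ i, (‖LpSum.setIntegral (s i) (h.measure_ne_top i) (LpSum.inl u : LpSum 𝕜 2 ∞ μ)‖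
        + ‖LpSum.setIntegral (s i) (h.measure_ne_top i) (LpSum.inr v : LpSum 𝕜 2 ∞ μ)‖) := by
        refine Finset.sum_le_sum fun i _ => ?_
        rw [hsplit, map_add]
        exact norm_add_le _ _
    _ ≤ ‖x‖ + ε := by
        rw [Finset.sum_add_distrib]
        linarith

theorem setIntegral_ind (h : EqualCells μ n s) (i : ι) :
    LpSum.setIntegral (s i) (h.measure_ne_top i) (h.ind 𝕜 i) = (n : 𝕜)⁻¹ := by
  have h1 : LpSum.setIntegral (s i) (h.measure_ne_top i) (h.ind 𝕜 i)
      = inner 𝕜 (h.indLp 𝕜 2 i) (h.indLp 𝕜 2 i) := (L2.inner_indicatorConstLp_one _ _ _).symm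
  rw [h1, indLp, L2.inner_indicatorConstLp_one_indicatorConstLp_one (h.measurableSet i)
    (h.measurableSet i) (h.measure_ne_top i) (h.measure_ne_top i), Set.inter_self, h.measureReal_eq]
  simp

/-- Some choice of signs makes the norm of the signed sum in `L_2` dominate the square sum, while
the signed indicators stay in the unit ball whatever their number. -/
theorem tendsto_norm_fst_apply_ind {s : ℕ → Set α} (h : EqualCells μ n s)
    (T : LpSum 𝕜 2 ∞ μ →L[𝕜] LpInter 𝕜 2 ∞ μ) :
    Filter.Tendsto (fun j => ‖LpInter.fst (T (h.ind 𝕜 j))‖ ^ 2) Filter.atTop (nhds 0) := by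
  refine (summable_of_sum_le (c := ‖T‖ ^ 2) (fun _ => sq_nonneg _) fun G => ?_).tendsto_atTop_zero
  obtain ⟨A, hA⟩ := exists_signs_sum_norm_sq_le (𝕜 := 𝕜) G fun j => LpInter.fst (T (h.ind 𝕜 j))
  refine hA.trans (pow_le_pow_left₀ (norm_nonneg _) ?_ 2)
  have : ∑ i ∈ G, rademacher 𝕜 A i • LpInter.fst (T (h.ind 𝕜 i))
      = LpInter.fst (T (∑ i ∈ G, rademacher 𝕜 A i • h.ind 𝕜 i)) := by
    simp [map_sum]
  rw [this]
  refine (LpInter.norm_fst_le _).trans ((T.le_opNorm _).trans ?_)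
  exact mul_le_of_le_one_right (norm_nonneg T) (h.norm_sum_rademacher_smul_ind_le_one A G)

/-- The number of cells is controlled by the distortion of an isomorphism. -/
theorem sqrt_le_of_equiv {s : ℕ → Set α} (h : EqualCells μ n s)
    (T : LpSum 𝕜 2 ∞ μ ≃L[𝕜] LpInter 𝕜 2 ∞ μ) {C : ℝ} (hC : 1 ≤ C) (hT : ∀ x, ‖T x‖ ≤ C * ‖x‖)
    (hT' : ∀ y, ‖T.symm y‖ ≤ C * ‖y‖) : √n ≤ 2 * C ^ 2 := by
  have hn : 0 < (n : ℝ) := by exact_mod_cast Nat.pos_of_ne_zero (NeZero.ne n)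
  have hC0 : 0 < C := zero_lt_one.trans_le hC
  -- Three factors `n` must be absorbed: the scaling `‖c‖ ^ 2 ≤ n`, the number of summands, and the
  -- cardinality in `SmallSquare`.
  have hη : (0 : ℝ) < ((n : ℝ) ^ 3)⁻¹ := by positivity
  obtain ⟨m, hm⟩ := Filter.eventually_atTop.1
    ((h.tendsto_norm_fst_apply_ind (T : LpSum 𝕜 2 ∞ μ →L[𝕜] LpInter 𝕜 2 ∞ μ)).eventually
      (gt_mem_nhds hη))
  set e : Fin n → ℕ := fun i => m + i with he
  have hinj : Function.Injective e := fun i j hij => Fin.ext (Nat.add_left_cancel hij)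
  have h' := h.comp hinj
  -- This scale cancels the constant `C / √n` in the upper `ℓ_2` estimate for the images.
  set c : 𝕜 := ((√(n : ℝ) / C : ℝ) : 𝕜) with hc
  have hcn : ‖c‖ ^ 2 = n / C ^ 2 := by
    rw [hc, RCLike.norm_ofReal, sq_abs, div_pow, Real.sq_sqrt hn.le]
  set f : Fin n → LpInter 𝕜 2 ∞ μ := fun i => c • T (h'.ind 𝕜 i) with hf
  have hsmall : LpInter.SmallSquare f := by
    constructor
    · refine LpInter.ae_sum_norm_sq_le_one fun a => ?_
      have h1 : ∑ i, a i • f i = c • T (∑ i, a i • h'.ind 𝕜 i) := by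
        simp_rw [hf, map_sum, Finset.smul_sum, map_smul, smul_comm c]
      rw [h1, norm_smul, mul_pow, hcn]
      calc (n : ℝ) / C ^ 2 * ‖T (∑ i, a i • h'.ind 𝕜 i)‖ ^ 2
          ≤ n / C ^ 2 * (C * ‖∑ i, a i • h'.ind 𝕜 i‖) ^ 2 := by
            gcongr
            exact hT _
        _ = n * ‖∑ i, a i • h'.ind 𝕜 i‖ ^ 2 := by field_simp
        _ ≤ n * ((n : ℝ)⁻¹ * ∑ i, ‖a i‖ ^ 2) := by
            gcongr
            exact h'.norm_sum_smul_ind_sq_le a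
        _ = ∑ i, ‖a i‖ ^ 2 := mul_inv_cancel_left₀ hn.ne' _
    · have h1 (i : Fin n) : ‖LpInter.fst (f i)‖ ^ 2 ≤ n * ((n : ℝ) ^ 3)⁻¹ := by
        have h2 : ‖LpInter.fst (T (h'.ind 𝕜 i))‖ ^ 2 < ((n : ℝ) ^ 3)⁻¹ :=
          hm (m + i) (Nat.le_add_right m i)
        rw [hf, map_smul, norm_smul, mul_pow, hcn]
        gcongr
        exact div_le_self hn.le (one_le_pow₀ hC)
      calc (Fintype.card (Fin n) : ℝ) * ∑ i, ‖LpInter.fst (f i)‖ ^ 2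
          ≤ Fintype.card (Fin n) * ∑ _i : Fin n, n * ((n : ℝ) ^ 3)⁻¹ := by
            gcongr with i
            exact h1 i
        _ = 1 := by
            simp
            field_simp
  have hψ (y : LpInter 𝕜 2 ∞ μ) :
      ∑ i, ‖(LpSum.setIntegral (s (e i)) (h'.measure_ne_top i) ∘ₗ
        (T.symm : LpInter 𝕜 2 ∞ μ →ₗ[𝕜] LpSum 𝕜 2 ∞ μ)) y‖ ≤ C * ‖y‖ :=
    (h'.sum_norm_setIntegral_le (Fintype.card_fin n).le (T.symm y)).trans (hT' y)
  have hmain := hsmall.norm_sum_apply_le hC0.le hψ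
  have hval (i : Fin n) : (LpSum.setIntegral (s (e i)) (h'.measure_ne_top i) ∘ₗ
      (T.symm : LpInter 𝕜 2 ∞ μ →ₗ[𝕜] LpSum 𝕜 2 ∞ μ)) (f i) = c * (n : 𝕜)⁻¹ := by
    rw [hf, map_smul, smul_eq_mul, ← h'.setIntegral_ind (𝕜 := 𝕜) i]
    simp
  have hn' : (n : 𝕜) ≠ 0 := Nat.cast_ne_zero.2 (NeZero.ne n)
  rw [Finset.sum_congr rfl fun i _ => hval i, Finset.sum_const, Finset.card_univ,
    Fintype.card_fin, nsmul_eq_mul, mul_left_comm, mul_inv_cancel₀ hn', mul_one, hc,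
    RCLike.norm_ofReal, abs_of_nonneg (by positivity), div_le_iff₀ hC0] at hmain
  linarith

end EqualCells

/-! ### Cells on the half-line and the contradiction. -/

theorem equalCells_halfLine (n : ℕ) [NeZero n] :
    EqualCells halfLine n fun j : ℕ => Set.Ioc ((j : ℝ) / n) ((j + 1 : ℝ) / n) where
  measurableSet _ := measurableSet_Ioc
  disjoint i j hij := by
    have hn : 0 < (n : ℝ) := by exact_mod_cast Nat.pos_of_ne_zero (NeZero.ne n)
    have hlt {i j : ℕ} (hij : i < j) : Disjoint (Set.Ioc ((i : ℝ) / n) ((i + 1 : ℝ) / n))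
        (Set.Ioc ((j : ℝ) / n) ((j + 1 : ℝ) / n)) := by
      refine Set.Ioc_disjoint_Ioc_of_le ?_
      gcongr
      exact_mod_cast hij
    rcases hij.lt_or_gt with h | h
    · exact hlt h
    · exact (hlt h).symm
  measure_eq j := by
    have hn : 0 < (n : ℝ) := by exact_mod_cast Nat.pos_of_ne_zero (NeZero.ne n)
    have hsub : Set.Ioc ((j : ℝ) / n) ((j + 1 : ℝ) / n) ⊆ Set.Ioi 0 := fun t ht =>
      lt_of_le_of_lt (by positivity) ht.1
    rw [halfLine, Measure.restrict_apply measurableSet_Ioc, Set.inter_eq_left.2 hsub,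
      Real.volume_Ioc, ← sub_div, add_sub_cancel_left, one_div, ENNReal.ofReal_inv_of_pos hn,
      ENNReal.ofReal_natCast]

theorem theorem2 {𝕜 : Type*} [RCLike 𝕜] :
    ¬ Nonempty ((LpSum 𝕜 2 ∞ halfLine) ≃L[𝕜] (LpInter 𝕜 2 ∞ halfLine)) := by
  rintro ⟨T⟩
  set T₁ : LpSum 𝕜 2 ∞ halfLine →L[𝕜] LpInter 𝕜 2 ∞ halfLine := T.toContinuousLinearMap
  set T₂ : LpInter 𝕜 2 ∞ halfLine →L[𝕜] LpSum 𝕜 2 ∞ halfLine :=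
    T.symm.toContinuousLinearMap
  set C : ℝ := 1 + ‖T₁‖ + ‖T₂‖ with hC
  have h1 : 0 ≤ ‖T₁‖ := norm_nonneg _
  have h2 : 0 ≤ ‖T₂‖ := norm_nonneg _
  obtain ⟨n, hn⟩ := exists_nat_gt ((2 * C ^ 2) ^ 2)
  have hn0 : 0 < n := by
    have : (0 : ℝ) < n := (sq_nonneg _).trans_lt hn
    exact_mod_cast this
  have : NeZero n := ⟨hn0.ne'⟩
  have hle := (equalCells_halfLine n).sqrt_le_of_equiv T (C := C) (by linarith)
    (fun x => (T₁.le_opNorm x).trans (by gcongr; linarith))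
    (fun y => (T₂.le_opNorm y).trans (by gcongr; linarith))
  exact absurd hle (not_le.2 (Real.lt_sqrt_of_sq_lt hn))
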